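/- Let $K$ be an algebraically closed field, complete with respect to a non-trivial non-archimedean absolute value $|\cdot|$. Let $\mathsf P^1$ be the Berkovich projective line over $K$, i.e. the one-point compactification by $\infty$ of the Berkovich affine line (the multiplicative seminorms $\mathcal S$ on $K[T]$ extending $|\cdot|$, with the topology of pointwise convergence); it contains $\mathbb P^1=K\cup\{\infty\}$ as a dense subset. For $\phi\in K[T]$ and $\mathcal S\in\mathsf P^1\setminus\{\infty\}$ write $|\phi|_{\mathrm{can}}(\mathcal S)$ for the value of the seminorm $\mathcal S$ at $\phi$; this is the continuous extension of $z\mapsto|\phi(z)|$. A polynomial acts on $\mathsf P^1\setminus\{\infty\}$ by $|\psi|_{\mathrm{can}}(\phi(\mathcal S))=|\psi\circ\phi|_{\mathrm{can}}(\mathcal S)$, and non-constant polynomials fix $\infty$. Let $[\cdot,\cdot]$ be the chordal distance on $\mathbb P^1$, normalized with the maximum norm on $K^2$, and for polynomials $\phi,\psi$ let $[\phi,\psi]_{\mathrm{can}}:\mathsf P^1\to[0,1]$ be the unique continuous extension of $z\mapsto[\phi(z),\psi(z)]$. Put $\log 0:=-\infty$. Let $f\in K[z]$ be a polynomial of degree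 $d>1$, with iterates $f^n$ $(n\ge 0)$, and let $a\in K[z]$ be any polynomial. Let $\mathsf K(f)$ be the set of $\mathcal S\in\mathsf P^1$ whose orbit $f^n(\mathcal S)$ does not converge to $\infty$, and let $\mathsf A_\infty(f)$ be the immediate attractive basin of $\infty$, i.e. the connected component containing $\infty$ of the set of points whose orbits converge to $\infty$. Then: 1. For every sequence $(n_j)\subset\mathbb N$ tending to $\infty$ and every $\mathcal S\in\mathsf A_\infty(f)\setminus\{\infty\}$, $$\lim_{j\to\infty}\frac1{d^{n_j}}\log[f^{n_j},a]_{\mathrm{can}}(\mathcal S)=0.$$ 2. There is a constant $M\in\mathbb R$ (depending on $f$ and $a$) such that for all $\mathcal S\in\mathsf K(f)$ and all $n\ge0$, $$\bigl|\log[f^n,a]_{\mathrm{can}}(\mathcal S)-\log|f^n-a|_{\mathrm{can}}(\mathcal S)\bigr|\le M,$$ where this is understood to say that both logarithms are $-\infty$ if one of them is. 3. Consequently, for every sequence $(n_j)\subset\mathbb N$ tending to $\infty$, one has $\lim_{j\to\infty}d^{-n_j}\log[f^{n_j},a]_{\mathrm{can}}(\mathcal S)=0$ for all $\mathcal S\in\mathsf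 P^1\setminus\mathbb P^1$ if and only if $\lim_{j\to\infty}d^{-n_j}\log|f^{n_j}-a|_{\mathrm{can}}(\mathcal S)=0$ for all $\mathcal S\in\mathsf K(f)\setminus\mathbb P^1$. -/

import Mathlib

open Filter Topology Polynomial OnePoint

noncomputable section

namespace BerkovichDynamics

variable {K : Type*} [NontriviallyNormedField K]

/-- The Berkovich affine line over `K`: multiplicative seminorms on `K[T]` that extend the
absolute value of `K`. For `S` and a polynomial `φ`, the number `S.abs φ` is `|φ|_can(S)`. -/
structure AffineLine (K : Type*) [NontriviallyNormedField K] where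
  /-- the multiplicative seminorm on `K[T]` -/
  abs : MulRingSeminorm K[X]
  abs_C : ∀ c : K, abs (C c) = ‖c‖

/-- The Berkovich topology: the coarsest one for which every `S ↦ |φ|_can(S)` is continuous. -/
instance : TopologicalSpace (AffineLine K) :=
  TopologicalSpace.induced (fun S (φ : K[X]) => S.abs φ) inferInstance

/-- The Berkovich projective line: the one-point compactification of the Berkovich affine line. -/
abbrev ProjLine (K : Type*) [NontriviallyNormedField K] : Type _ := OnePoint (AffineLine K)

/-- The classical point `z ∈ K`, as the seminorm `φ ↦ |φ(z)|`. -/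
def AffineLine.ofPoint (z : K) : AffineLine K where
  abs :=
    { toFun := fun φ => ‖φ.eval z‖
      map_zero' := by simp
      add_le' := fun φ ψ => by simpa using norm_add_le (φ.eval z) (ψ.eval z)
      neg' := fun φ => by simp
      map_one' := by simp
      map_mul' := fun φ ψ => by simp }
  abs_C := fun c => by
    change ‖(C c).eval z‖ = ‖c‖
    simp

/-- The inclusion of the classical projective line `K ∪ {∞}` in the Berkovich projective line. -/
def classical (z : OnePoint K) : ProjLine K :=
  z.elim ∞ fun w => ((AffineLine.ofPoint w : AffineLine K) : ProjLine K)

/-- The action of a polynomial on the Berkovich affine line: `|ψ|(φ(S)) = |ψ ∘ φ|(S)`. -/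
def AffineLine.map (φ : K[X]) (S : AffineLine K) : AffineLine K where
  abs :=
    { toFun := fun ψ => S.abs (ψ.comp φ)
      map_zero' := by simp
      add_le' := fun ψ χ => by simpa using map_add_le_add S.abs (ψ.comp φ) (χ.comp φ)
      neg' := fun ψ => by simp
      map_one' := by simp
      map_mul' := fun ψ χ => by simp }
  abs_C := fun c => by
    change S.abs ((C c).comp φ) = ‖c‖
    simpa using S.abs_C c

/-- The action of a polynomial on `K ∪ {∞}`; a nonconstant polynomial fixes `∞`. -/
def polyMap (φ : K[X]) (z : OnePoint K) : OnePoint K :=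
  z.elim (if φ.natDegree = 0 then ((φ.coeff 0 : K) : OnePoint K) else ∞)
    fun w => ((φ.eval w : K) : OnePoint K)

/-- The action of a polynomial on the Berkovich projective line. -/
def berkMap (φ : K[X]) (S : ProjLine K) : ProjLine K :=
  S.elim (classical (polyMap φ ∞)) fun T => ((T.map φ : AffineLine K) : ProjLine K)

/-- Homogeneous coordinates of a point of `K ∪ {∞}`: `(1, z)` for `z ∈ K` and `(0, 1)` for `∞`. -/
def homCoord (z : OnePoint K) : K × K :=
  z.elim (0, 1) fun w => (1, w)

/-- The normalized chordal distance `|p ∧ q| / (‖p‖ ‖q‖)`, where `K × K` has the maximum norm. -/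
def chordal (z w : OnePoint K) : ℝ :=
  ‖(homCoord z).1 * (homCoord w).2 - (homCoord z).2 * (homCoord w).1‖ /
    (‖homCoord z‖ * ‖homCoord w‖)

/-- The proximity function `[φ, ψ]_can` of two polynomials: the continuous extension to the
Berkovich projective line of the function `z ↦ [φ(z), ψ(z)]` on the classical one. -/
def prox (φ ψ : K[X]) (S : ProjLine K) : ℝ :=
  limUnder (comap classical (𝓝 S)) fun z => chordal (polyMap φ z) (polyMap ψ z)

/-- The `n`-th iterate `f^n` of a polynomial under composition. -/
def iter (f : K[X]) (n : ℕ) : K[X] := f.comp^[n] X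

/-- The filled-in Julia set: the points whose orbit does not converge to `∞`. -/
def filledJulia (f : K[X]) : Set (ProjLine K) :=
  {S | ¬ Tendsto (fun n : ℕ => (berkMap f)^[n] S) atTop (𝓝 ∞)}

/-- The immediate attractive basin of `∞`: the connected component containing `∞` of the set of
points whose orbit converges to `∞`. -/
def immediateBasin (f : K[X]) : Set (ProjLine K) :=
  connectedComponentIn {S | Tendsto (fun n : ℕ => (berkMap f)^[n] S) atTop (𝓝 ∞)} ∞

/-- The logarithm of a nonnegative real number, with `elog 0 = -∞`. -/
def elog (x : ℝ) : EReal := ENNReal.log (ENNReal.ofReal x)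

/-- `d^{-n_j} log [f^{n_j}, a]_can(S) → 0`, where `d = deg f`. -/
def ProxLimit (f a : K[X]) (n : ℕ → ℕ) (S : ProjLine K) : Prop :=
  Tendsto (fun j => ((((f.natDegree : ℝ) ^ n j)⁻¹ : ℝ) : EReal) * elog (prox (iter f (n j)) a S))
    atTop (𝓝 0)

/-- `d^{-n_j} log |f^{n_j} - a|_can(S) → 0`, where `d = deg f`. -/
def AbsLimit (f a : K[X]) (n : ℕ → ℕ) (S : AffineLine K) : Prop :=
  Tendsto (fun j => ((((f.natDegree : ℝ) ^ n j)⁻¹ : ℝ) : EReal) * elog (S.abs (iter f (n j) - a)))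
    atTop (𝓝 0)

end BerkovichDynamics

end

open Filter Topology Polynomial OnePoint

noncomputable section

namespace BerkovichDynamics

variable {K : Type*} [NontriviallyNormedField K]

namespace AffineLine

/-! On the affine line `[φ, ψ]` equals `|φ - ψ| / (max 1 |φ| * max 1 |ψ|)` (`prox_coe`): this
expression is continuous, agrees with the chordal distance at classical points, and these are dense
(`denseRange_ofPoint`). An orbit tends to `∞` exactly when `|f^n|` does. In that case the
ultrametric inequality gives `|f^n - a| = |f^n|` eventually, so the proximity is the positive
constant `1 / max 1 |a|`, whose logarithm is killed by `d^{-n_j}`. Otherwise an escape radius bounds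
every `|f^n|`, and hence also `|a|`, uniformly in the point (`exists_bound_of_mem_filledJulia`). The
denominator then lies between `1` and a constant, which gives `M`. A bounded error disappears after
division by `d^{n_j}`, so the equivalence follows by treating escaping and non-escaping points
separately. -/

/-! ### Seminorms on the Berkovich affine line -/

theorem abs_injective : Function.Injective (abs : AffineLine K → MulRingSeminorm K[X]) := by
  rintro ⟨a, ha⟩ ⟨b, hb⟩ h
  cases h
  rfl

theorem map_abs (φ ψ : K[X]) (S : AffineLine K) : (S.map φ).abs ψ = S.abs (ψ.comp φ) := rfl

theorem ofPoint_abs (z : K) (φ : K[X]) : (ofPoint z).abs φ = ‖φ.eval z‖ := rfl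

theorem map_map (φ ψ : K[X]) (S : AffineLine K) : (S.map φ).map ψ = S.map (ψ.comp φ) := by
  apply abs_injective
  ext χ
  simp only [map_abs, comp_assoc]

theorem map_X (S : AffineLine K) : S.map X = S := by
  apply abs_injective
  ext χ
  simp only [map_abs, comp_X]

theorem isInducing_abs : IsInducing (fun (S : AffineLine K) (φ : K[X]) => S.abs φ) := ⟨rfl⟩

theorem continuous_abs (φ : K[X]) : Continuous fun S : AffineLine K => S.abs φ :=
  (continuous_apply φ).comp isInducing_abs.continuous

/-- A multiplicative seminorm extending a nonarchimedean absolute value is nonarchimedean. -/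
theorem isNonarchimedean [IsUltrametricDist K] (S : AffineLine K) : IsNonarchimedean S.abs := by
  intro φ ψ
  set B := max (S.abs φ) (S.abs ψ) with hB
  have hB0 : 0 ≤ B := (apply_nonneg _ _).trans (le_max_left _ _)
  -- Binomial expansion; integers have norm at most `1`. The factor `m + 1` is beaten by any
  -- exponential, so it is lost on taking `m`-th roots.
  have key (m : ℕ) : S.abs (φ + ψ) ^ m ≤ (m + 1) * B ^ m := by
    rw [← map_pow, add_pow]
    calc _ ≤ ∑ k ∈ Finset.range (m + 1), S.abs (φ ^ k * ψ ^ (m - k) * (m.choose k : K[X])) :=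
          Finset.le_sum_of_subadditive S.abs (map_zero _).le (map_add_le_add _) _ _
      _ ≤ ∑ k ∈ Finset.range (m + 1), B ^ m := by
          refine Finset.sum_le_sum fun k hk => ?_
          have hc : S.abs (m.choose k : K[X]) ≤ 1 := by
            rw [← C_eq_natCast, S.abs_C]
            exact IsUltrametricDist.norm_natCast_le_one K _
          have hk' : k + (m - k) = m := by
            have := Finset.mem_range.1 hk
            omega
          rw [map_mul, map_mul, map_pow, map_pow]
          calc _ ≤ B ^ k * B ^ (m - k) * 1 := by
                gcongr
                · exact le_max_left _ _
                · exact le_max_right _ _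
            _ = B ^ m := by rw [mul_one, ← pow_add, hk']
      _ = (m + 1) * B ^ m := by simp
  refine le_of_forall_gt_imp_ge_of_dense fun a ha => ?_
  rcases hB0.eq_or_lt with h0 | h0
  · have := key 1
    rw [← h0] at this ha
    simp only [pow_one, mul_zero] at this
    exact this.trans ha.le
  · obtain ⟨m, hm⟩ := Real.exists_natCast_add_one_lt_pow_of_one_lt ((one_lt_div h0).2 ha)
    rw [div_pow, lt_div_iff₀ (by positivity)] at hm
    have hm0 : m ≠ 0 := by
      rintro rfl
      simp at hm
    exact le_of_pow_le_pow_left₀ hm0 (h0.trans ha).le ((key m).trans hm.le)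

theorem abs_add_eq_of_lt [IsUltrametricDist K] (S : AffineLine K) {φ ψ : K[X]}
    (h : S.abs ψ < S.abs φ) : S.abs (φ + ψ) = S.abs φ := by
  rw [IsNonarchimedean.add_eq_max_of_ne S.isNonarchimedean h.ne', max_eq_left h.le]

theorem abs_sub_eq_of_lt [IsUltrametricDist K] (S : AffineLine K) {φ ψ : K[X]}
    (h : S.abs ψ < S.abs φ) : S.abs (φ - ψ) = S.abs φ := by
  rw [sub_eq_add_neg]
  exact S.abs_add_eq_of_lt (by rwa [map_neg_eq_map])

/-- Over an algebraically closed field a seminorm is determined by its values on the linear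
polynomials `X - C c`. -/
theorem abs_eq_prod_roots [IsAlgClosed K] (S : AffineLine K) (φ : K[X]) :
    S.abs φ = ‖φ.leadingCoeff‖ * (φ.roots.map fun c => S.abs (X - C c)).prod := by
  conv_lhs => rw [(IsAlgClosed.splits φ).eq_prod_roots]
  rw [map_mul, S.abs_C, map_multiset_prod, Multiset.map_map]
  rfl

theorem abs_le_sum (S : AffineLine K) (φ : K[X]) {R : ℝ} (h : S.abs X ≤ R) :
    S.abs φ ≤ ∑ i ∈ φ.support, ‖φ.coeff i‖ * R ^ i := by
  conv_lhs => rw [φ.as_sum_support_C_mul_X_pow]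
  refine (Finset.le_sum_of_subadditive S.abs (map_zero _).le (map_add_le_add _) _ _).trans
    (Finset.sum_le_sum fun i _ => ?_)
  rw [map_mul, map_pow, S.abs_C]
  gcongr

end AffineLine

/-! ### Density of the classical points -/

section Density

theorem exists_lt_norm_lt_of_isAlgClosed [IsAlgClosed K] {r s : ℝ} (hr : 0 ≤ r) (hrs : r < s) :
    ∃ w : K, r < ‖w‖ ∧ ‖w‖ < s := by
  rcases hr.eq_or_lt with rfl | hr
  · exact NormedField.exists_norm_lt K hrs
  obtain ⟨c, hc⟩ := NormedField.exists_one_lt_norm K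
  obtain ⟨n, hn⟩ := pow_unbounded_of_one_lt ‖c‖ ((one_lt_div hr).2 hrs)
  have hn0 : n ≠ 0 := by
    rintro rfl
    simp only [pow_zero] at hn
    exact absurd hn hc.not_gt
  -- The root `e` has norm strictly between `1` and `s / r`, so its powers cannot jump over the
  -- interval `(r, s)`.
  obtain ⟨e, he⟩ := IsAlgClosed.exists_pow_nat_eq c (Nat.pos_of_ne_zero hn0)
  rw [← he, norm_pow] at hn hc
  have h1 : 1 < ‖e‖ := by
    by_contra h
    exact hc.not_ge (pow_le_one₀ (norm_nonneg _) (not_lt.1 h))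
  have h2 : ‖e‖ < s / r := lt_of_pow_lt_pow_left₀ n (div_nonneg (hr.trans hrs).le hr.le) hn
  obtain ⟨m, hm1, hm2⟩ := exists_mem_Ico_zpow hr h1
  refine ⟨e ^ (m + 1), by rwa [norm_zpow], ?_⟩
  rw [norm_zpow, zpow_add_one₀ (one_pos.trans h1).ne']
  rw [lt_div_iff₀ hr] at h2
  nlinarith

theorem exists_seq_norm_tendsto [IsAlgClosed K] {r : ℝ} (hr : 0 ≤ r) :
    ∃ w : ℕ → K, (∀ k, r < ‖w k‖) ∧ Tendsto (fun k => ‖w k‖) atTop (𝓝 r) := by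
  have h (k : ℕ) : ∃ w : K, r < ‖w‖ ∧ ‖w‖ < r + 1 / ((k : ℝ) + 1) :=
    exists_lt_norm_lt_of_isAlgClosed hr (by linarith [Nat.one_div_pos_of_nat (α := ℝ) (n := k)])
  choose w hw1 hw2 using h
  refine ⟨w, hw1, ?_⟩
  refine tendsto_of_tendsto_of_tendsto_of_le_of_le tendsto_const_nhds ?_
    (fun k => (hw1 k).le) fun k => (hw2 k).le
  simpa using (tendsto_const_nhds (x := r)).add tendsto_one_div_add_atTop_nhds_zero_nat

/-- On linear polynomials with roots in a finite set, every point of the Berkovich affine line is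
a limit of classical points. -/
theorem exists_seq_tendsto_linear [IsUltrametricDist K] [IsAlgClosed K] (S : AffineLine K)
    (s : Finset K) :
    ∃ z : ℕ → K, ∀ c ∈ s, Tendsto (fun k => ‖z k - c‖) atTop (𝓝 (S.abs (X - C c))) := by
  rcases s.eq_empty_or_nonempty with rfl | hs
  · exact ⟨fun _ => 0, by simp⟩
  -- Take the centre in `s` closest to `S`, and approach the disc of radius `r` about it through
  -- points at distance slightly more than `r`.
  obtain ⟨c₀, hc₀, hmin⟩ := s.exists_min_image (fun c => S.abs (X - C c)) hs
  set r := S.abs (X - C c₀) with hr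
  obtain ⟨w, hw, hlim⟩ := exists_seq_norm_tendsto (K := K) (apply_nonneg S.abs (X - C c₀))
  refine ⟨fun k => c₀ + w k, fun c hc => ?_⟩
  have e1 : S.abs (X - C c) = max r ‖c₀ - c‖ := by
    have e : (X - C c : K[X]) = (X - C c₀) + C (c₀ - c) := by rw [C_sub]; ring
    have hle : S.abs (X - C c) ≤ max r ‖c₀ - c‖ := by
      have := S.isNonarchimedean (X - C c₀) (C (c₀ - c))
      rwa [← e, S.abs_C] at this
    rcases le_or_gt ‖c₀ - c‖ r with h | h
    · rw [max_eq_left h] at hle ⊢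
      exact le_antisymm hle (hmin c hc)
    · rw [max_eq_right h.le, e, add_comm, S.abs_add_eq_of_lt (by rwa [S.abs_C]), S.abs_C]
  have e2 : ∀ᶠ k in atTop, max ‖w k‖ ‖c₀ - c‖ = ‖c₀ + w k - c‖ := by
    -- The strict inequality `r < ‖w k‖` excludes a tie when `‖c₀ - c‖ ≤ r`; otherwise the limit `r`
    -- does.
    have hne : ∀ᶠ k in atTop, ‖w k‖ ≠ ‖c₀ - c‖ := by
      rcases le_or_gt ‖c₀ - c‖ r with h | h
      · exact Eventually.of_forall fun k => (h.trans_lt (hw k)).ne'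
      · exact (hlim.eventually_lt_const h).mono fun k hk => hk.ne
    filter_upwards [hne] with k hk
    rw [show c₀ + w k - c = w k + (c₀ - c) by ring,
      IsUltrametricDist.norm_add_eq_max_of_norm_ne_norm hk]
  rw [e1]
  exact (hlim.max tendsto_const_nhds).congr' e2

theorem exists_seq_tendsto_eval [IsUltrametricDist K] [IsAlgClosed K] (S : AffineLine K)
    {I : Set K[X]} (hI : I.Finite) :
    ∃ z : ℕ → K, ∀ φ ∈ I, Tendsto (fun k => ‖φ.eval (z k)‖) atTop (𝓝 (S.abs φ)) := by
  classical
  obtain ⟨z, hz⟩ := exists_seq_tendsto_linear S (hI.toFinset.biUnion fun φ => φ.roots.toFinset)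
  refine ⟨z, fun φ hφ => ?_⟩
  rw [S.abs_eq_prod_roots]
  have e (k : ℕ) : ‖φ.eval (z k)‖ =
      ‖φ.leadingCoeff‖ * (φ.roots.map fun c => ‖z k - c‖).prod := by
    rw [← AffineLine.ofPoint_abs, AffineLine.abs_eq_prod_roots]
    simp [AffineLine.ofPoint_abs]
  simp only [e]
  refine tendsto_const_nhds.mul (tendsto_multiset_prod _ fun c hc => hz c ?_)
  exact Finset.mem_biUnion.2 ⟨φ, hI.mem_toFinset.2 hφ, Multiset.mem_toFinset.2 hc⟩

/-- The classical points are dense in the Berkovich affine line. -/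
theorem denseRange_ofPoint [IsUltrametricDist K] [IsAlgClosed K] :
    DenseRange (AffineLine.ofPoint : K → AffineLine K) := by
  intro S
  rw [mem_closure_iff_nhds]
  intro t ht
  rw [AffineLine.isInducing_abs.nhds_eq_comap, mem_comap, nhds_pi] at ht
  obtain ⟨u, hu, hut⟩ := ht
  obtain ⟨I, hI, v, hv, hvu⟩ := Filter.mem_pi.1 hu
  obtain ⟨z, hz⟩ := exists_seq_tendsto_eval S hI
  have h : ∀ᶠ k in atTop, ∀ φ ∈ I, ‖φ.eval (z k)‖ ∈ v φ :=
    (eventually_all_finite hI).2 fun φ hφ => hz φ hφ (hv φ)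
  obtain ⟨k, hk⟩ := h.exists
  exact ⟨AffineLine.ofPoint (z k), hut (hvu hk), z k, rfl⟩

/-- Makes the limit that defines `prox` unique. -/
theorem comap_classical_neBot [IsUltrametricDist K] [IsAlgClosed K] (S : AffineLine K) :
    (comap classical (𝓝 (S : ProjLine K))).NeBot := by
  refine comap_neBot fun t ht => ?_
  rw [nhds_coe_eq, mem_map] at ht
  obtain ⟨_, hT, z, rfl⟩ := mem_closure_iff_nhds.1 (denseRange_ofPoint S) _ ht
  exact ⟨(z : OnePoint K), hT⟩

end Density

/-! ### Explicit formula for the proximity function -/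

section Proximity

theorem norm_homCoord_coe (w : K) : ‖homCoord (w : OnePoint K)‖ = max 1 ‖w‖ := by
  change ‖((1 : K), w)‖ = _
  rw [Prod.norm_mk, norm_one]

theorem chordal_coe (z w : K) :
    chordal (z : OnePoint K) (w : OnePoint K) = ‖z - w‖ / (max 1 ‖z‖ * max 1 ‖w‖) := by
  rw [chordal, norm_homCoord_coe, norm_homCoord_coe]
  change ‖1 * w - z * 1‖ / _ = _
  rw [one_mul, mul_one, norm_sub_rev]

/-- The proximity function on the Berkovich affine line. -/
theorem prox_coe [IsUltrametricDist K] [IsAlgClosed K] (φ ψ : K[X]) (S : AffineLine K) :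
    prox φ ψ S = S.abs (φ - ψ) / (max 1 (S.abs φ) * max 1 (S.abs ψ)) := by
  have := comap_classical_neBot S
  refine Tendsto.limUnder_eq ?_
  -- The value at `∞` is arbitrary: a neighbourhood of `S` avoids it.
  let G : ProjLine K → ℝ := fun T =>
    T.elim 0 fun T => T.abs (φ - ψ) / (max 1 (T.abs φ) * max 1 (T.abs ψ))
  have hG : ContinuousAt G (S : ProjLine K) := by
    rw [continuousAt_coe]
    refine Continuous.continuousAt (Continuous.div (AffineLine.continuous_abs _)
      ((continuous_const.max (AffineLine.continuous_abs _)).mul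
        (continuous_const.max (AffineLine.continuous_abs _))) fun T => ?_)
    positivity
  refine Tendsto.congr' ?_ (hG.tendsto.comp tendsto_comap)
  have hne : ∀ᶠ T in 𝓝 (S : ProjLine K), T ≠ ∞ :=
    isClosed_infty.isOpen_compl.mem_nhds (OnePoint.coe_ne_infty S)
  filter_upwards [tendsto_comap.eventually hne] with z hz
  induction z using OnePoint.rec with
  | infty => exact absurd rfl hz
  | coe z =>
    change _ = chordal ((φ.eval z : K) : OnePoint K) ((ψ.eval z : K) : OnePoint K)
    rw [chordal_coe, ← eval_sub]
    rfl

end Proximity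

/-! ### Neighbourhoods of infinity and escape of orbits -/

section Infinity

theorem isCompact_setOf_abs_X_le (R : ℝ) : IsCompact {S : AffineLine K | S.abs X ≤ R} := by
  rw [AffineLine.isInducing_abs.isCompact_iff]
  refine (isCompact_univ_pi fun φ : K[X] =>
    isCompact_Icc (a := (0 : ℝ)) (b := ∑ i ∈ φ.support, ‖φ.coeff i‖ * R ^ i)).of_isClosed_subset
      ?_ ?_
  · have e : (fun (S : AffineLine K) (φ : K[X]) => S.abs φ) '' {S | S.abs X ≤ R} =
        {g : K[X] → ℝ | g X ≤ R} ∩ {g | ∀ φ ψ, g (φ + ψ) ≤ g φ + g ψ} ∩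
          {g | ∀ φ, g (-φ) = g φ} ∩ {g | ∀ φ ψ, g (φ * ψ) = g φ * g ψ} ∩
          {g | ∀ c : K, g (C c) = ‖c‖} := by
      ext g
      constructor
      · rintro ⟨S, hS, rfl⟩
        exact ⟨⟨⟨⟨hS, map_add_le_add S.abs⟩, map_neg_eq_map S.abs⟩, map_mul S.abs⟩, S.abs_C⟩
      · rintro ⟨⟨⟨⟨hX, hadd⟩, hneg⟩, hmul⟩, hC⟩
        exact ⟨⟨{ toFun := g
                  map_zero' := by simpa using hC 0
                  add_le' := hadd
                  neg' := hneg
                  map_one' := by simpa using hC 1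
                  map_mul' := hmul }, hC⟩, hX, rfl⟩
    rw [e]
    simp only [Set.ofPred_forall]
    refine ((((isClosed_le (by fun_prop) (by fun_prop)).inter ?_).inter ?_).inter ?_).inter ?_
    · exact isClosed_iInter fun φ => isClosed_iInter fun ψ =>
        isClosed_le (by fun_prop) (by fun_prop)
    · exact isClosed_iInter fun φ => isClosed_eq (by fun_prop) (by fun_prop)
    · exact isClosed_iInter fun φ => isClosed_iInter fun ψ =>
        isClosed_eq (by fun_prop) (by fun_prop)
    · exact isClosed_iInter fun c => isClosed_eq (by fun_prop) (by fun_prop)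
  · rintro _ ⟨S, hS, rfl⟩ φ -
    exact ⟨apply_nonneg _ _, S.abs_le_sum φ hS⟩

theorem tendsto_coe_infty_iff {ι : Type*} {l : Filter ι} {S : ι → AffineLine K} :
    Tendsto (fun i => (S i : ProjLine K)) l (𝓝 ∞) ↔
      Tendsto (fun i => (S i).abs X) l atTop := by
  rw [show (fun i => (S i : ProjLine K)) = OnePoint.some ∘ S from rfl, ← tendsto_comap_iff,
    comap_coe_nhds_infty]
  constructor
  · intro h
    refine tendsto_atTop.2 fun R => ?_
    have hR : {S : AffineLine K | S.abs X ≤ R}ᶜ ∈ coclosedCompact (AffineLine K) :=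
      (isCompact_setOf_abs_X_le R).compl_mem_coclosedCompact_of_isClosed
        (isClosed_le (AffineLine.continuous_abs X) continuous_const)
    exact (h.eventually hR).mono fun i hi => (not_le.1 hi).le
  · intro h
    refine (hasBasis_coclosedCompact.tendsto_right_iff).2 fun t ht => ?_
    obtain ⟨R, hR⟩ := (ht.2.image (AffineLine.continuous_abs X)).bddAbove
    filter_upwards [h.eventually_gt_atTop R] with i hi hit
    exact hi.not_ge (hR ⟨S i, hit, rfl⟩)

theorem iter_succ (f : K[X]) (n : ℕ) : iter f (n + 1) = f.comp (iter f n) :=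
  Function.iterate_succ_apply' _ _ _

theorem berkMap_iterate_coe (f : K[X]) (S : AffineLine K) (n : ℕ) :
    (berkMap f)^[n] (S : ProjLine K) = (S.map (iter f n) : AffineLine K) := by
  induction n with
  | zero =>
    change (S : ProjLine K) = (S.map X : AffineLine K)
    rw [S.map_X]
  | succ n ih =>
    rw [Function.iterate_succ_apply', ih, iter_succ, ← AffineLine.map_map]
    rfl

/-- The orbit of `S` tends to `∞` if and only if `|f^n|(S)` tends to `∞`. -/
theorem tendsto_berkMap_iterate_iff (f : K[X]) (S : AffineLine K) :
    Tendsto (fun n : ℕ => (berkMap f)^[n] (S : ProjLine K)) atTop (𝓝 ∞) ↔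
      Tendsto (fun n => S.abs (iter f n)) atTop atTop := by
  simp only [berkMap_iterate_coe, tendsto_coe_infty_iff, AffineLine.map_abs, X_comp]

/-- Outside a large disc a polynomial of degree at least two at least doubles `|T|`. -/
theorem exists_escape_radius [IsUltrametricDist K] [IsAlgClosed K] (f : K[X])
    (hd : 1 < f.natDegree) :
    ∃ R : ℝ, 1 ≤ R ∧ ∀ S : AffineLine K, R < S.abs X → 2 * S.abs X ≤ S.abs f := by
  classical
  have hlc : 0 < ‖f.leadingCoeff‖ := by
    rw [norm_pos_iff, leadingCoeff_ne_zero]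
    rintro rfl
    simp at hd
  obtain ⟨B, hB⟩ := (f.roots.toFinset.image norm).bddAbove
  -- Beyond `B` every factor `|T - c|` equals `|T|`; beyond `1` the power `|T|^d` dominates `|T|^2`;
  -- the last bound yields the factor `2`.
  refine ⟨max 1 (max B (2 / ‖f.leadingCoeff‖)), le_max_left _ _, fun S hS => ?_⟩
  obtain ⟨h1, h2, h3⟩ : 1 < S.abs X ∧ B < S.abs X ∧ 2 / ‖f.leadingCoeff‖ < S.abs X := by
    simpa only [max_lt_iff] using hS
  have e : (f.roots.map fun c => S.abs (X - C c)) = f.roots.map fun _ => S.abs X := by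
    refine Multiset.map_congr rfl fun c hc => S.abs_sub_eq_of_lt ?_
    rw [S.abs_C]
    refine lt_of_le_of_lt (hB ?_) h2
    exact Finset.mem_coe.2 (Finset.mem_image_of_mem _ (Multiset.mem_toFinset.2 hc))
  rw [S.abs_eq_prod_roots f, e, Multiset.map_const', Multiset.prod_replicate,
    ← (IsAlgClosed.splits f).natDegree_eq_card_roots]
  rw [div_lt_iff₀ hlc] at h3
  calc 2 * S.abs X ≤ S.abs X * ‖f.leadingCoeff‖ * S.abs X := by gcongr
    _ = ‖f.leadingCoeff‖ * S.abs X ^ 2 := by ring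
    _ ≤ ‖f.leadingCoeff‖ * S.abs X ^ f.natDegree := by
      gcongr
      · exact h1.le
      · exact hd

/-- The iterates of `f` are uniformly bounded on the filled-in Julia set. -/
theorem exists_bound_of_mem_filledJulia [IsUltrametricDist K] [IsAlgClosed K] (f : K[X])
    (hd : 1 < f.natDegree) :
    ∃ R : ℝ, 1 ≤ R ∧ ∀ S : AffineLine K, (S : ProjLine K) ∈ filledJulia f →
      ∀ n, S.abs (iter f n) ≤ R := by
  obtain ⟨R, hR1, hR⟩ := exists_escape_radius f hd
  refine ⟨R, hR1, fun S hS n => ?_⟩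
  by_contra! hn
  refine hS ((tendsto_berkMap_iterate_iff f S).2 ?_)
  have step (m : ℕ) (hm : R < S.abs (iter f m)) :
      2 * S.abs (iter f m) ≤ S.abs (iter f (m + 1)) := by
    have := hR (S.map (iter f m))
    simp only [AffineLine.map_abs, X_comp] at this
    rw [iter_succ]
    exact this hm
  have growth (k : ℕ) : 2 ^ k * R < S.abs (iter f (k + n)) := by
    induction k with
    | zero => simpa using hn
    | succ k ih =>
      have hk : R ≤ 2 ^ k * R := le_mul_of_one_le_left (by linarith) (one_le_pow₀ one_le_two)
      have := step _ (hk.trans_lt ih)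
      rw [show k + 1 + n = k + n + 1 by ring, pow_succ]
      linarith
  rw [← tendsto_add_atTop_iff_nat n]
  exact tendsto_atTop_mono (fun k => (growth k).le)
    ((tendsto_pow_atTop_atTop_of_one_lt one_lt_two).atTop_mul_const (by linarith))

end Infinity

/-! ### Normalized logarithms and their limits -/

section Limits

theorem elog_mono {x y : ℝ} (h : x ≤ y) : elog x ≤ elog y :=
  ENNReal.log_le_log_iff.2 (ENNReal.ofReal_le_ofReal h)

theorem elog_of_pos {x : ℝ} (hx : 0 < x) : elog x = (Real.log x : EReal) := by
  rw [elog, ENNReal.log_ofReal, if_neg hx.not_ge]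

theorem elog_mul {x y : ℝ} (hx : 0 ≤ x) : elog (x * y) = elog x + elog y := by
  rw [elog, ENNReal.ofReal_mul hx, ENNReal.log_mul_add]
  rfl

theorem tendsto_inv_pow_mul_coe {d : ℕ} (hd : 1 < d) {n : ℕ → ℕ} (hn : Tendsto n atTop atTop)
    (x : ℝ) :
    Tendsto (fun j => ((((d : ℝ) ^ n j)⁻¹ : ℝ) : EReal) * (x : EReal)) atTop (𝓝 0) := by
  simp only [← EReal.coe_mul]
  rw [← EReal.coe_zero, EReal.tendsto_coe]
  have h : Tendsto (fun m : ℕ => ((d : ℝ) ^ m)⁻¹ * x) atTop (𝓝 (0 * x)) :=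
    ((tendsto_pow_atTop_atTop_of_one_lt (Nat.one_lt_cast.2 hd)).inv_tendsto_atTop).mul_const x
  rw [zero_mul] at h
  exact h.comp hn

/-- If `u ≤ v + M` and `v ≤ u + M`, then `u` and `v` are interchangeable in limits normalized by
`d^{-n_j}`. -/
theorem tendsto_inv_pow_mul_of_le_add {d : ℕ} (hd : 1 < d) {n : ℕ → ℕ}
    (hn : Tendsto n atTop atTop) {u v : ℕ → EReal} {M : ℝ} (huv : ∀ j, u j ≤ v j + (M : EReal))
    (hvu : ∀ j, v j ≤ u j + (M : EReal))
    (hu : Tendsto (fun j => ((((d : ℝ) ^ n j)⁻¹ : ℝ) : EReal) * u j) atTop (𝓝 0)) :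
    Tendsto (fun j => ((((d : ℝ) ^ n j)⁻¹ : ℝ) : EReal) * v j) atTop (𝓝 0) := by
  have hc (j : ℕ) : (0 : EReal) ≤ ((((d : ℝ) ^ n j)⁻¹ : ℝ) : EReal) :=
    EReal.coe_nonneg.2 (by positivity)
  have shift (N : ℝ) : Tendsto (fun j => ((((d : ℝ) ^ n j)⁻¹ : ℝ) : EReal) * (u j + (N : EReal)))
      atTop (𝓝 0) := by
    -- Addition on `EReal` is not continuous everywhere, but it is at `(0, 0)`.
    have h0 : ContinuousAt (fun p : EReal × EReal => p.1 + p.2) (0, 0) :=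
      EReal.continuousAt_add (Or.inl EReal.zero_ne_top) (Or.inl EReal.zero_ne_bot)
    have h := h0.tendsto.comp (hu.prodMk_nhds (tendsto_inv_pow_mul_coe hd hn N))
    simp only [add_zero] at h
    refine h.congr fun j => ?_
    exact (EReal.left_distrib_of_nonneg_of_ne_top (hc j) (EReal.coe_ne_top _) _ _).symm
  refine tendsto_of_tendsto_of_tendsto_of_le_of_le (shift (-M)) (shift M)
    (fun j => mul_le_mul_of_nonneg_left ?_ (hc j)) fun j => mul_le_mul_of_nonneg_left (hvu j) (hc j)
  rw [EReal.coe_neg, ← sub_eq_add_neg]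
  exact EReal.sub_le_of_le_add (huv j)

/-- On the basin of `∞` the proximity of `f^n` and `a` is eventually constant and positive. -/
theorem proxLimit_of_tendsto [IsUltrametricDist K] [IsAlgClosed K] (f a : K[X])
    (hd : 1 < f.natDegree) {n : ℕ → ℕ} (hn : Tendsto n atTop atTop) (S : AffineLine K)
    (hS : Tendsto (fun n : ℕ => (berkMap f)^[n] (S : ProjLine K)) atTop (𝓝 ∞)) :
    ProxLimit f a n S := by
  rw [tendsto_berkMap_iterate_iff] at hS
  refine (tendsto_inv_pow_mul_coe hd hn (Real.log (max 1 (S.abs a))⁻¹)).congr' ?_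
  filter_upwards [(hS.comp hn).eventually_gt_atTop (max 1 (S.abs a))] with j hj
  obtain ⟨h1, h2⟩ := max_lt_iff.1 hj
  simp only [Function.comp_apply] at h1 h2
  have hpos : 0 < S.abs (iter f (n j)) := one_pos.trans h1
  rw [← elog_of_pos (by positivity), prox_coe, S.abs_sub_eq_of_lt h2, max_eq_right h1.le,
    div_mul_cancel_left₀ hpos.ne']

/-- On the filled-in Julia set `log [f^n, a]` and `log |f^n - a|` differ by a bounded amount. -/
theorem exists_bound_elog_prox [IsUltrametricDist K] [IsAlgClosed K] (f a : K[X])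
    (hd : 1 < f.natDegree) :
    ∃ M : ℝ, ∀ S : AffineLine K, (S : ProjLine K) ∈ filledJulia f → ∀ n : ℕ,
      elog (prox (iter f n) a S) ≤ elog (S.abs (iter f n - a)) + (M : EReal) ∧
      elog (S.abs (iter f n - a)) ≤ elog (prox (iter f n) a S) + (M : EReal) := by
  obtain ⟨R, hR1, hR⟩ := exists_bound_of_mem_filledJulia f hd
  -- Bounds `|a|` on the filled-in Julia set, where `|T| ≤ R` by the case `n = 0` of `hR`.
  set B := max 1 (∑ i ∈ a.support, ‖a.coeff i‖ * R ^ i)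
  have hRB : 1 ≤ R * B := one_le_mul_of_one_le_of_one_le hR1 (le_max_left _ _)
  refine ⟨Real.log (R * B), fun S hS n => ?_⟩
  have ha : S.abs a ≤ B := (S.abs_le_sum a (hR S hS 0)).trans (le_max_right _ _)
  have hD1 : 1 ≤ max 1 (S.abs (iter f n)) * max 1 (S.abs a) :=
    one_le_mul_of_one_le_of_one_le (le_max_left _ _) (le_max_left _ _)
  have hDB : max 1 (S.abs (iter f n)) * max 1 (S.abs a) ≤ R * B := by
    gcongr
    · exact max_le hR1 (hR S hS n)
    · exact max_le (le_max_left _ _) ha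
  have h0 : 0 ≤ S.abs (iter f n - a) := apply_nonneg _ _
  rw [← elog_of_pos (by linarith), prox_coe, ← elog_mul h0, ← elog_mul (by positivity)]
  constructor <;> apply elog_mono
  · exact (div_le_self h0 hD1).trans (le_mul_of_one_le_right h0 hRB)
  · rw [div_mul_eq_mul_div, le_div_iff₀ (by linarith)]
    gcongr

end Limits

end BerkovichDynamics

end

theorem mainTheorem7 {K : Type*} [NontriviallyNormedField K] [IsUltrametricDist K]
    [CompleteSpace K] [IsAlgClosed K] (f a : Polynomial K) (hd : 1 < f.natDegree) :
    (∀ n : ℕ → ℕ, Filter.Tendsto n Filter.atTop Filter.atTop →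
      ∀ S ∈ BerkovichDynamics.immediateBasin f, S ≠ OnePoint.infty →
        BerkovichDynamics.ProxLimit f a n S) ∧
    (∃ M : ℝ, ∀ S : BerkovichDynamics.AffineLine K,
      (S : BerkovichDynamics.ProjLine K) ∈ BerkovichDynamics.filledJulia f → ∀ n : ℕ,
        BerkovichDynamics.elog (BerkovichDynamics.prox (BerkovichDynamics.iter f n) a S) ≤
          BerkovichDynamics.elog (S.abs (BerkovichDynamics.iter f n - a)) + (M : EReal) ∧
        BerkovichDynamics.elog (S.abs (BerkovichDynamics.iter f n - a)) ≤
          BerkovichDynamics.elog (BerkovichDynamics.prox (BerkovichDynamics.iter f n) a S) +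
            (M : EReal)) ∧
    (∀ n : ℕ → ℕ, Filter.Tendsto n Filter.atTop Filter.atTop →
      ((∀ S : BerkovichDynamics.ProjLine K, S ∉ Set.range BerkovichDynamics.classical →
          BerkovichDynamics.ProxLimit f a n S) ↔
        ∀ S : BerkovichDynamics.AffineLine K,
          (S : BerkovichDynamics.ProjLine K) ∈
            BerkovichDynamics.filledJulia f \ Set.range BerkovichDynamics.classical →
          BerkovichDynamics.AbsLimit f a n S)) := by
  open BerkovichDynamics in
  obtain ⟨M, hM⟩ := exists_bound_elog_prox f a hd
  refine ⟨fun n hn S hS hS' => ?_, ⟨M, hM⟩, fun n hn => ⟨fun h S hS => ?_, fun h S hS => ?_⟩⟩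
  · obtain ⟨T, rfl⟩ := OnePoint.ne_infty_iff_exists.1 hS'
    exact proxLimit_of_tendsto f a hd hn T (connectedComponentIn_subset _ _ hS)
  · exact tendsto_inv_pow_mul_of_le_add hd hn (fun j => (hM S hS.1 (n j)).1)
      (fun j => (hM S hS.1 (n j)).2) (h S hS.2)
  · have hS' : S ≠ OnePoint.infty := fun e => hS ⟨OnePoint.infty, e.symm⟩
    obtain ⟨T, rfl⟩ := OnePoint.ne_infty_iff_exists.1 hS'
    by_cases hT : (T : ProjLine K) ∈ filledJulia f
    · exact tendsto_inv_pow_mul_of_le_add hd hn (fun j => (hM T hT (n j)).2)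
        (fun j => (hM T hT (n j)).1) (h T ⟨hT, hS⟩)
    -- Outside the filled-in Julia set the orbit escapes, so the proximity limit is automatic.
    · exact proxLimit_of_tendsto f a hd hn T (not_not.1 hT)
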